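/- **Interpolation theorem for quantum $L^p$-spaces.** Let $n\in\mathbb N$, $H=L^2(\mathbb R^n)$. For $1\le p<\infty$ and a compact operator $A$ on $H$ with singular values $s_k(A)$ (the eigenvalues of $|A|=(A^*A)^{1/2}$, repeated according to multiplicity) put $\|A\|_{T^p}=\bigl(\sum_k s_k(A)^p\bigr)^{1/p}\in[0,\infty]$, and let $\|A\|_{T^\infty}$ be the operator norm; let $T^1(H)$ be the space of trace-class operators, i.e. the compact operators $A$ with $\|A\|_{T^1}<\infty$. For $1\le p\le\infty$ put $$L^p_{\mathrm{QHA}}=\bigl\{(f,A)\in L^1(\mathbb R^{2n})\oplus T^1(H):\ \|(f,A)\|_{L^p}:=\|f\|_{L^p(\mathbb R^{2n})}+\|A\|_{T^p}<\infty\bigr\}.$$ Let $1\le p_0<p_1\le\infty$, $0<\theta<1$, and let $p_\theta$ be given by $$\frac1{p_\theta}=\frac{1-\theta}{p_0}+\frac{\theta}{p_1}\qquad(1/\infty=0).$$ Then for every $(f,A)\in L^{p_0}_{\mathrm{QHA}}\cap L^{p_1}_{\mathrm{QHA}}$, $$\|(f,A)\|_{L^{p_\theta}}\le\|(f,A)\|_{L^{p_0}}^{1-\theta}\,\|(f,A)\|_{L^{p_1}}^{\theta}.$$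 -/

import Mathlib

open MeasureTheory
open scoped ENNReal

noncomputable section

namespace QHA

section Schatten

variable {H : Type*} [NormedAddCommGroup H] [InnerProductSpace ℂ H] [CompleteSpace H]

/-- The multiplicity of `s` as a singular value of `A`: the dimension (possibly `∞`) of the
eigenspace `ker (|A| - s)`, where `|A| = (A* A)^(1/2)`. -/
def singularMultiplicity (A : H →L[ℂ] H) (s : ℝ) : ℕ∞ :=
  Cardinal.toENat (Module.rank ℂ
    (Module.End.eigenspace ((CFC.abs A : H →L[ℂ] H) : H →ₗ[ℂ] H) (s : ℂ)))

/-- The Schatten norm `‖A‖_{T^p}` of a compact operator `A`, with values in `[0, ∞]`: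
for `p < ∞` it is `(∑ s^p)^(1/p)`, the sum running over the nonzero singular values of `A`
(the positive eigenvalues of `|A|`) repeated according to multiplicity;
for `p = ∞` it is the operator norm. -/
def schattenENorm (p : ℝ≥0∞) (A : H →L[ℂ] H) : ℝ≥0∞ :=
  if p = ∞ then ‖A‖ₑ
  else (∑' s : Set.Ioi (0 : ℝ),
    (singularMultiplicity A s : ℝ≥0∞) * ENNReal.ofReal (s : ℝ) ^ p.toReal) ^ (1 / p.toReal)

/-- The Schatten class `T^p(H)`: the compact operators with finite Schatten `p`-norm. -/
def schattenClass (H : Type*) [NormedAddCommGroup H] [InnerProductSpace ℂ H] [CompleteSpace H]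
    (p : ℝ≥0∞) : Set (H →L[ℂ] H) :=
  {A | IsCompactOperator A ∧ schattenENorm p A < ∞}

end Schatten

/-- The Hilbert space `H = L²(ℝⁿ)`. -/
abbrev L2 (n : ℕ) : Type := Lp ℂ 2 (volume : Measure (EuclideanSpace ℝ (Fin n)))

/-- The space `L¹(ℝ²ⁿ)`. -/
abbrev L1Phase (n : ℕ) : Type := Lp ℂ 1 (volume : Measure (EuclideanSpace ℝ (Fin (2 * n))))

/-- `‖(f, A)‖_p = ‖f‖_{L^p} + ‖A‖_{T^p}`, with values in `[0, ∞]`. -/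
def qhaENorm {n : ℕ} (p : ℝ≥0∞) (x : L1Phase n × (L2 n →L[ℂ] L2 n)) : ℝ≥0∞ :=
  eLpNorm x.1 p volume + schattenENorm p x.2

/-- The quantum `L^p`-space: the pairs `(f, A)` in `L¹(ℝ²ⁿ) ⊕ T¹(L²(ℝⁿ))` with
`‖(f, A)‖_p < ∞`. -/
def qhaSpace (n : ℕ) (p : ℝ≥0∞) : Set (L1Phase n × (L2 n →L[ℂ] L2 n)) :=
  {x | x.2 ∈ schattenClass (L2 n) 1 ∧ qhaENorm p x < ∞}

end QHA

end

/-!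
Each of the two summands of the norm is log-convex in `1 / p`. For an `L^p` norm over an arbitrary
measure this is Hölder's inequality applied to `|f| = |f|^(1 - θ) |f|^θ`. For `p < ∞` the Schatten
norm of `A` is the `L^p` norm of the identity function with respect to the discrete measure giving
each singular value its multiplicity as mass; for `p = ∞` the latter is at most `‖A‖`, which
suffices because `∞` can occur as the intermediate exponent only if both endpoints are `∞`.
Hölder's inequality for sums of two terms then combines the two estimates.
-/

namespace QHA

section Exponents

variable {p₀ p₁ pθ : ℝ≥0∞} {θ : ℝ}

theorem interpolated_ne_zero (hp₀ : p₀ ≠ 0) (hp₁ : p₁ ≠ 0)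
    (hpθ : 1 / pθ = ENNReal.ofReal (1 - θ) / p₀ + ENNReal.ofReal θ / p₁) : pθ ≠ 0 := by
  have hfin : 1 / pθ ≠ ∞ := hpθ ▸ ENNReal.add_ne_top.2
    ⟨ENNReal.div_ne_top ENNReal.ofReal_ne_top hp₀, ENNReal.div_ne_top ENNReal.ofReal_ne_top hp₁⟩
  rintro rfl
  simp at hfin

theorem endpoints_eq_top (hθ₀ : 0 < θ) (hθ₁ : θ < 1)
    (hp : 1 / ∞ = ENNReal.ofReal (1 - θ) / p₀ + ENNReal.ofReal θ / p₁) : p₀ = ∞ ∧ p₁ = ∞ := by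
  simpa [hθ₀.not_ge, hθ₁.not_ge] using hp.symm

theorem holderTriple_div_ofReal (hθ₀ : 0 < θ) (hθ₁ : θ < 1)
    (hpθ : 1 / pθ = ENNReal.ofReal (1 - θ) / p₀ + ENNReal.ofReal θ / p₁) :
    ENNReal.HolderTriple (p₀ / ENNReal.ofReal (1 - θ)) (p₁ / ENNReal.ofReal θ) pθ where
  inv_add_inv_eq_inv := by
    have inv_div_ofReal (p : ℝ≥0∞) {t : ℝ} (ht : 0 < t) :
        (p / ENNReal.ofReal t)⁻¹ = ENNReal.ofReal t / p :=
      ENNReal.inv_div (.inl ENNReal.ofReal_ne_top) (.inl (ENNReal.ofReal_pos.2 ht).ne')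
    rw [inv_div_ofReal p₀ (sub_pos.2 hθ₁), inv_div_ofReal p₁ hθ₀, ← hpθ, one_div]

end Exponents

theorem sum_rpow_mul_rpow_le {ι : Type*} (s : Finset ι) (a b : ι → ℝ≥0∞) {θ : ℝ}
    (hθ₀ : 0 < θ) (hθ₁ : θ < 1) :
    ∑ i ∈ s, a i ^ (1 - θ) * b i ^ θ ≤ (∑ i ∈ s, a i) ^ (1 - θ) * (∑ i ∈ s, b i) ^ θ := by
  simpa [← ENNReal.rpow_mul, (sub_pos.2 hθ₁).ne', hθ₀.ne'] using
    ENNReal.inner_le_Lp_mul_Lq s (fun i ↦ a i ^ (1 - θ)) (fun i ↦ b i ^ θ)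
      (.one_sub_inv_inv hθ₀ hθ₁)

section Lebesgue

variable {α E : Type*} [MeasurableSpace α] {μ : Measure α} [NormedAddCommGroup E]

theorem eLpNorm_norm_rpow_div_ofReal (f : α → E) (p : ℝ≥0∞) {t : ℝ} (ht : 0 < t) :
    eLpNorm (fun x ↦ ‖f x‖ ^ t) (p / ENNReal.ofReal t) μ = eLpNorm f p μ ^ t := by
  rw [eLpNorm_norm_rpow f ht,
    ENNReal.div_mul_cancel (ENNReal.ofReal_pos.2 ht).ne' ENNReal.ofReal_ne_top]

theorem eLpNorm_le_rpow_mul_rpow {f : α → E} (hf : AEStronglyMeasurable f μ) {p₀ p₁ pθ : ℝ≥0∞}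
    {θ : ℝ} (hθ₀ : 0 < θ) (hθ₁ : θ < 1)
    (hpθ : 1 / pθ = ENNReal.ofReal (1 - θ) / p₀ + ENNReal.ofReal θ / p₁) :
    eLpNorm f pθ μ ≤ eLpNorm f p₀ μ ^ (1 - θ) * eLpNorm f p₁ μ ^ θ := by
  have hθ' : 0 < 1 - θ := sub_pos.2 hθ₁
  have := holderTriple_div_ofReal hθ₀ hθ₁ hpθ
  have norm_eq (x : α) : ‖f x‖ = ‖f x‖ ^ (1 - θ) * ‖f x‖ ^ θ := by
    rw [← Real.rpow_add_of_nonneg (norm_nonneg _) hθ'.le hθ₀.le, sub_add_cancel, Real.rpow_one]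
  have aesm_norm_rpow {t : ℝ} (ht : 0 < t) : AEStronglyMeasurable (fun x ↦ ‖f x‖ ^ t) μ :=
    (Real.continuous_rpow_const ht.le).comp_aestronglyMeasurable hf.norm
  calc eLpNorm f pθ μ
      = eLpNorm ((fun x ↦ ‖f x‖ ^ (1 - θ)) • fun x ↦ ‖f x‖ ^ θ) pθ μ :=
        eLpNorm_congr_norm_ae <| .of_forall fun x ↦ by
          rw [Pi.smul_apply', smul_eq_mul, ← norm_eq, norm_norm]
    _ ≤ eLpNorm (fun x ↦ ‖f x‖ ^ (1 - θ)) (p₀ / ENNReal.ofReal (1 - θ)) μ *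
          eLpNorm (fun x ↦ ‖f x‖ ^ θ) (p₁ / ENNReal.ofReal θ) μ :=
        eLpNorm_smul_le_mul_eLpNorm (aesm_norm_rpow hθ₀) (aesm_norm_rpow hθ')
    _ = eLpNorm f p₀ μ ^ (1 - θ) * eLpNorm f p₁ μ ^ θ := by
        rw [eLpNorm_norm_rpow_div_ofReal f p₀ hθ', eLpNorm_norm_rpow_div_ofReal f p₁ hθ₀]

end Lebesgue

theorem norm_le_opNorm_of_hasEigenvalue {𝕜 E : Type*} [NontriviallyNormedField 𝕜]
    [NormedAddCommGroup E] [NormedSpace 𝕜 E] {T : E →L[𝕜] E} {c : 𝕜}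
    (hc : Module.End.HasEigenvalue (T : E →ₗ[𝕜] E) c) : ‖c‖ ≤ ‖T‖ := by
  obtain ⟨v, hv⟩ := hc.exists_hasEigenvector
  have hTv : T v = c • v := hv.apply_eq_smul
  refine le_of_mul_le_mul_right ?_ (norm_pos_iff.2 hv.2)
  rw [← norm_smul, ← hTv]
  exact T.le_opNorm v

section Schatten

variable {H : Type*} [NormedAddCommGroup H] [InnerProductSpace ℂ H] [CompleteSpace H]

theorem hasEigenvalue_abs_of_singularMultiplicity_ne_zero {A : H →L[ℂ] H} {s : ℝ}
    (hs : singularMultiplicity A s ≠ 0) :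
    Module.End.HasEigenvalue ((CFC.abs A : H →L[ℂ] H) : H →ₗ[ℂ] H) (s : ℂ) := by
  refine Module.End.hasEigenvalue_iff.2 fun hbot ↦ hs ?_
  rw [singularMultiplicity, hbot, rank_bot, map_zero]

theorem le_norm_of_singularMultiplicity_ne_zero {A : H →L[ℂ] H} {s : ℝ}
    (hs : singularMultiplicity A s ≠ 0) : s ≤ ‖A‖ :=
  calc s ≤ ‖(s : ℂ)‖ := by simpa using le_abs_self s
    _ ≤ ‖CFC.abs A‖ :=
      norm_le_opNorm_of_hasEigenvalue (hasEigenvalue_abs_of_singularMultiplicity_ne_zero hs)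
    _ = ‖A‖ := CFC.norm_abs

/-- The distribution of the nonzero singular values of `A` on the real line, counted with
multiplicity; its `p`-th absolute moment is the `p`-th power of the Schatten norm. -/
noncomputable def singularMeasure (A : H →L[ℂ] H) : Measure ℝ :=
  .sum fun s : Set.Ioi (0 : ℝ) ↦ (singularMultiplicity A s : ℝ≥0∞) • .dirac (s : ℝ)

theorem lintegral_singularMeasure (A : H →L[ℂ] H) (g : ℝ → ℝ≥0∞) :
    ∫⁻ s, g s ∂singularMeasure A =
      ∑' s : Set.Ioi (0 : ℝ), (singularMultiplicity A s : ℝ≥0∞) * g s := by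
  simp [singularMeasure, lintegral_sum_measure, lintegral_smul_measure, lintegral_dirac]

theorem ae_singularMeasure_enorm_le (A : H →L[ℂ] H) : ∀ᵐ s ∂singularMeasure A, ‖s‖ₑ ≤ ‖A‖ₑ := by
  refine (Measure.ae_sum_iff' (measurableSet_le measurable_enorm measurable_const)).2 fun s ↦ ?_
  by_cases hs : singularMultiplicity A s = 0
  · simp [hs]
  refine Measure.ae_smul_measure ?_ _
  rw [ae_dirac_eq, Filter.eventually_pure, Real.enorm_eq_ofReal s.2.le, ← ofReal_norm]
  exact ENNReal.ofReal_le_ofReal (le_norm_of_singularMultiplicity_ne_zero hs)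

theorem schattenENorm_eq_eLpNorm (A : H →L[ℂ] H) {p : ℝ≥0∞} (hp₀ : p ≠ 0) (hp : p ≠ ∞) :
    schattenENorm p A = eLpNorm id p (singularMeasure A) := by
  rw [schattenENorm, if_neg hp, eLpNorm_eq_lintegral_rpow_enorm_toReal hp₀ hp,
    lintegral_singularMeasure]
  simp_rw [id_eq, fun s : Set.Ioi (0 : ℝ) ↦ Real.enorm_eq_ofReal s.2.le]

-- The inequality may be strict at `p = ∞` when `A` is not compact, as `‖A‖` need not be
-- an eigenvalue of `|A|`.
theorem eLpNorm_singularMeasure_le_schattenENorm (A : H →L[ℂ] H) {p : ℝ≥0∞} (hp₀ : p ≠ 0) :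
    eLpNorm id p (singularMeasure A) ≤ schattenENorm p A := by
  rcases eq_or_ne p ∞ with rfl | hp
  · rw [schattenENorm, if_pos rfl, eLpNorm_exponent_top]
    exact eLpNormEssSup_le_of_ae_enorm_bound (ae_singularMeasure_enorm_le A)
  · exact (schattenENorm_eq_eLpNorm A hp₀ hp).ge

theorem schattenENorm_le_rpow_mul_rpow (A : H →L[ℂ] H) {p₀ p₁ pθ : ℝ≥0∞} {θ : ℝ}
    (hp₀ : p₀ ≠ 0) (hp₁ : p₁ ≠ 0) (hθ₀ : 0 < θ) (hθ₁ : θ < 1)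
    (hpθ : 1 / pθ = ENNReal.ofReal (1 - θ) / p₀ + ENNReal.ofReal θ / p₁) :
    schattenENorm pθ A ≤ schattenENorm p₀ A ^ (1 - θ) * schattenENorm p₁ A ^ θ := by
  have hθ' : 0 ≤ 1 - θ := sub_nonneg.2 hθ₁.le
  rcases eq_or_ne pθ ∞ with rfl | hpθ_top
  · obtain ⟨rfl, rfl⟩ := endpoints_eq_top hθ₀ hθ₁ hpθ
    rw [← ENNReal.rpow_add_of_nonneg _ _ hθ' hθ₀.le, sub_add_cancel, ENNReal.rpow_one]
  calc schattenENorm pθ A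
      = eLpNorm id pθ (singularMeasure A) :=
        schattenENorm_eq_eLpNorm A (interpolated_ne_zero hp₀ hp₁ hpθ) hpθ_top
    _ ≤ eLpNorm id p₀ (singularMeasure A) ^ (1 - θ) * eLpNorm id p₁ (singularMeasure A) ^ θ :=
        eLpNorm_le_rpow_mul_rpow aestronglyMeasurable_id hθ₀ hθ₁ hpθ
    _ ≤ schattenENorm p₀ A ^ (1 - θ) * schattenENorm p₁ A ^ θ := by
        gcongr <;> exact eLpNorm_singularMeasure_le_schattenENorm A ‹_›

end Schatten

end QHA

theorem mainTheorem1_general {α E H : Type*} [MeasurableSpace α] {μ : Measure α}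
    [NormedAddCommGroup E] [NormedAddCommGroup H] [InnerProductSpace ℂ H] [CompleteSpace H]
    {p₀ p₁ pθ : ℝ≥0∞} {θ : ℝ} (hp₀ : p₀ ≠ 0) (hp₁ : p₁ ≠ 0) (hθ₀ : 0 < θ) (hθ₁ : θ < 1)
    (hpθ : 1 / pθ = ENNReal.ofReal (1 - θ) / p₀ + ENNReal.ofReal θ / p₁)
    {f : α → E} (hf : AEStronglyMeasurable f μ) (A : H →L[ℂ] H) :
    eLpNorm f pθ μ + QHA.schattenENorm pθ A ≤
      (eLpNorm f p₀ μ + QHA.schattenENorm p₀ A) ^ (1 - θ) *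
        (eLpNorm f p₁ μ + QHA.schattenENorm p₁ A) ^ θ :=
  calc eLpNorm f pθ μ + QHA.schattenENorm pθ A
      ≤ eLpNorm f p₀ μ ^ (1 - θ) * eLpNorm f p₁ μ ^ θ +
          QHA.schattenENorm p₀ A ^ (1 - θ) * QHA.schattenENorm p₁ A ^ θ :=
        add_le_add (QHA.eLpNorm_le_rpow_mul_rpow hf hθ₀ hθ₁ hpθ)
          (QHA.schattenENorm_le_rpow_mul_rpow A hp₀ hp₁ hθ₀ hθ₁ hpθ)
    _ ≤ _ := by
        simpa using QHA.sum_rpow_mul_rpow_le Finset.univ ![eLpNorm f p₀ μ, QHA.schattenENorm p₀ A]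
          ![eLpNorm f p₁ μ, QHA.schattenENorm p₁ A] hθ₀ hθ₁

theorem mainTheorem1 (n : ℕ) (p₀ p₁ pθ : ℝ≥0∞) (θ : ℝ)
    (hp₀ : 1 ≤ p₀) (hp : p₀ < p₁) (hθ₀ : 0 < θ) (hθ₁ : θ < 1)
    (hpθ : 1 / pθ = ENNReal.ofReal (1 - θ) / p₀ + ENNReal.ofReal θ / p₁)
    (f : QHA.L1Phase n) (A : QHA.L2 n →L[ℂ] QHA.L2 n)
    (h₀ : (f, A) ∈ QHA.qhaSpace n p₀) (h₁ : (f, A) ∈ QHA.qhaSpace n p₁) :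
    QHA.qhaENorm pθ (f, A) ≤
      QHA.qhaENorm p₀ (f, A) ^ (1 - θ) * QHA.qhaENorm p₁ (f, A) ^ θ :=
  mainTheorem1_general (zero_lt_one.trans_le hp₀).ne' hp.ne_bot hθ₀ hθ₁ hpθ
    (Lp.aestronglyMeasurable f) A
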